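/- **Theorem (Scalar Maximum Principle).** Let $M$ be a closed (compact, without boundary, Hausdorff) smooth manifold, let $J\subseteq[0,\infty)$ be an interval containing $0$, let $g(t)$, $t\in J$, be a one-parameter family of smooth Riemannian metrics on $M$, and let $F:\mathbb R\to\mathbb R$ be locally Lipschitz. Denote by $\Delta_{g(t)}$ the Laplace–Beltrami operator of $g(t)$, i.e. the trace of the covariant Hessian. A $C^2$ function $u:M\times J\to\mathbb R$ is called a *supersolution* of $$\frac{\partial v}{\partial t}=\Delta_{g(t)}v+F(v)$$ if $\frac{\partial u}{\partial t}\ge\Delta_{g(t)}u+F(u)$ on $M\times J$, and a *subsolution* if $\frac{\partial u}{\partial t}\le\Delta_{g(t)}u+F(u)$ on $M\times J$ (time derivatives at endpoints of $J$ being one-sided). 1. Let $u$ be a $C^2$ supersolution, let $C_1\in\mathbb R$ be such that $u(x,0)\ge C_1$ for all $x\in M$, and let $\phi_1$ be a solution of $\phi_1'=F(\phi_1)$, $\phi_1(0)=C_1$, on an interval $K\ni 0$. Then $u(x,t)\ge\phi_1(t)$ for all $x\in M$ and all $t\in J\cap K$. 2. Let $u$ be a $C^2$ subsolution, let $C_2\in\mathbb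 R$ be such that $u(x,0)\le C_2$ for all $x\in M$, and let $\phi_2$ be a solution of $\phi_2'=F(\phi_2)$, $\phi_2(0)=C_2$, on an interval $K\ni 0$. Then $u(x,t)\le\phi_2(t)$ for all $x\in M$ and all $t\in J\cap K$. -/

import Mathlib

open scoped Manifold ContDiff

noncomputable section

namespace ScalarMax

/-- Smooth Riemannian metrics on an `n`-dimensional smooth manifold `M` (without boundary). -/
abbrev Metric (n : ℕ) (M : Type*) [TopologicalSpace M] [ChartedSpace (EuclideanSpace ℝ (Fin n)) M]
    [IsManifold (𝓡 n) ∞ M] :=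
  Bundle.ContMDiffRiemannianMetric (𝓡 n) ∞ (EuclideanSpace ℝ (Fin n))
    (fun x : M => TangentSpace (𝓡 n) x)

/-- The partial derivative `∂ᵢ h` of a function on Euclidean space. -/
def partialDeriv {n : ℕ} (i : Fin n) (h : EuclideanSpace ℝ (Fin n) → ℝ)
    (y : EuclideanSpace ℝ (Fin n)) : ℝ :=
  fderiv ℝ h y (EuclideanSpace.single i 1)

section Laplacian

variable {n : ℕ} {M : Type*} [TopologicalSpace M] [ChartedSpace (EuclideanSpace ℝ (Fin n)) M]
  [IsManifold (𝓡 n) ∞ M]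

/-- The coordinate vector field `∂ᵢ` of the preferred chart around `p`, at the point of `M` with
coordinates `y`. -/
def coordVector (p : M) (i : Fin n) (y : EuclideanSpace ℝ (Fin n)) :
    TangentSpace (𝓡 n) ((extChartAt (𝓡 n) p).symm y) :=
  mfderiv 𝓘(ℝ, EuclideanSpace ℝ (Fin n)) (𝓡 n) (extChartAt (𝓡 n) p).symm y
    (EuclideanSpace.single i (1 : ℝ))

/-- The matrix `(g_ij)` of the metric in the preferred chart around `p`,
`g_ij (y) = g (∂ᵢ, ∂ⱼ)`, as a function of the coordinates. -/
def metricMatrix (g : Metric n M) (p : M) (y : EuclideanSpace ℝ (Fin n)) :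
    Matrix (Fin n) (Fin n) ℝ :=
  Matrix.of fun i j =>
    g.inner ((extChartAt (𝓡 n) p).symm y) (coordVector p i y) (coordVector p j y)

/-- The Christoffel symbol of the Levi-Civita connection of `g` in the preferred chart around `p`,
`Γᵏ_ij = ½ ∑ₗ gᵏˡ (∂ᵢ g_jl + ∂ⱼ g_il - ∂ₗ g_ij)`. -/
def christoffel (g : Metric n M) (p : M) (k i j : Fin n) (y : EuclideanSpace ℝ (Fin n)) : ℝ :=
  (1 / 2) * ∑ l, (metricMatrix g p y)⁻¹ k l *
    (partialDeriv i (fun z => metricMatrix g p z j l) y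
      + partialDeriv j (fun z => metricMatrix g p z i l) y
      - partialDeriv l (fun z => metricMatrix g p z i j) y)

/-- The covariant Hessian `(∇² f)_ij = ∂ᵢ ∂ⱼ f - ∑ₖ Γᵏ_ij ∂ₖ f` of `f`, in the preferred chart
around `p`. -/
def hessian (g : Metric n M) (f : M → ℝ) (p : M) (i j : Fin n)
    (y : EuclideanSpace ℝ (Fin n)) : ℝ :=
  partialDeriv i (partialDeriv j (f ∘ (extChartAt (𝓡 n) p).symm)) y
    - ∑ k, christoffel g p k i j y * partialDeriv k (f ∘ (extChartAt (𝓡 n) p).symm) y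

/-- The Laplace-Beltrami operator `Δ_g f = ∑ᵢⱼ gⁱʲ (∇² f)_ij`, the trace of the covariant Hessian.
The value at `p` does not depend on the chart; it is computed in the preferred chart around `p`. -/
def laplacian (g : Metric n M) (f : M → ℝ) (p : M) : ℝ :=
  ∑ i, ∑ j, (metricMatrix g p (extChartAt (𝓡 n) p p))⁻¹ i j *
    hessian g f p i j (extChartAt (𝓡 n) p p)

/-- `u` is of class `C²` jointly in space and time, on `M × J`. -/
def IsC2On (J : Set ℝ) (u : M → ℝ → ℝ) : Prop :=
  ContMDiffOn ((𝓡 n).prod 𝓘(ℝ, ℝ)) 𝓘(ℝ, ℝ) 2 (fun q : M × ℝ => u q.1 q.2) (Set.univ ×ˢ J)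

/-- `u` is a `C²` supersolution on `M × J` of `∂v/∂t = Δ_{g(t)} v + F(v)`. The time derivative is
one-sided at an endpoint of the interval `J` that belongs to `J`. -/
structure IsSupersolution (g : ℝ → Metric n M) (F : ℝ → ℝ) (J : Set ℝ) (u : M → ℝ → ℝ) :
    Prop where
  isC2 : IsC2On (n := n) J u
  ge : ∀ x : M, ∀ t ∈ J,
    derivWithin (fun s => u x s) J t ≥ laplacian (g t) (fun y => u y t) x + F (u x t)

/-- `u` is a `C²` subsolution on `M × J` of `∂v/∂t = Δ_{g(t)} v + F(v)`. -/
structure IsSubsolution (g : ℝ → Metric n M) (F : ℝ → ℝ) (J : Set ℝ) (u : M → ℝ → ℝ) :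
    Prop where
  isC2 : IsC2On (n := n) J u
  le : ∀ x : M, ∀ t ∈ J,
    derivWithin (fun s => u x s) J t ≤ laplacian (g t) (fun y => u y t) x + F (u x t)

end Laplacian

/-- `φ` solves `φ' = F(φ)`, `φ(0) = C` on the interval `K` containing `0` (with one-sided
derivatives at endpoints of `K` that belong to `K`). -/
structure IsODESolution (F : ℝ → ℝ) (C : ℝ) (K : Set ℝ) (φ : ℝ → ℝ) : Prop where
  ordConnected : K.OrdConnected
  zero_mem : (0 : ℝ) ∈ K
  initial : φ 0 = C
  hasDeriv : ∀ t ∈ K, HasDerivWithinAt φ (F (φ t)) K t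

end ScalarMax

end

/-!
The maximum principle is the comparison of a supersolution with a spatially constant solution.
If `u < φ` somewhere on `M × [0, T]`, let `L` be a Lipschitz constant of `F` on the compact set of
values of `u` and `φ` there, and let `(x₀, t₀)` be a point where `e^{-(L+1)t} (u - φ)` attains its
(negative) minimum on `M × [0, T]`; it has `t₀ > 0`. As `x₀` is a minimum of `u(·, t₀)`, the
Laplacian of `u` at `(x₀, t₀)` is nonnegative (`laplacian_nonneg_of_isLocalMin`), so
`∂ₜ(u - φ) ≥ F(u) - F(φ) ≥ L (u - φ)`. As `t₀` is a minimum on `[0, t₀]` of the weighted difference,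
`∂ₜ(u - φ) ≤ (L + 1) (u - φ)`. Together these give `u - φ ≥ 0` at `(x₀, t₀)`, a contradiction.

At a minimum the first derivatives vanish, so the Christoffel symbols do not contribute to the
covariant Hessian, which is positive semidefinite by the second derivative test; its trace with
respect to a positive semidefinite matrix is nonnegative. The statement about subsolutions follows
by passing from `u` and `F` to `-u` and `-F(-·)`.
-/

open scoped Manifold ContDiff Topology
open Filter Set

/-! ### Necessary conditions at a minimum, and positive semidefinite matrices -/

/-- The second-order necessary condition at a local minimum. -/
lemma IsLocalMin.fderiv_fderiv_nonneg {E : Type*} [NormedAddCommGroup E] [NormedSpace ℝ E]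
    {f : E → ℝ} {x : E} (hmin : IsLocalMin f x) (hf : ContDiffAt ℝ 2 f x) (v : E) :
    0 ≤ fderiv ℝ (fderiv ℝ f) x v v := by
  have hline (s : ℝ) : HasDerivAt (fun s : ℝ => x + s • v) v s := by
    simpa using ((hasDerivAt_id s).smul_const v).const_add x
  have hcont : Tendsto (fun s : ℝ => x + s • v) (𝓝 0) (𝓝 x) := by
    simpa using (hline 0).continuousAt.tendsto
  have hdiff : ∀ᶠ y in 𝓝 x, DifferentiableAt ℝ f y :=
    (hf.eventually (by simp)).mono fun y hy => hy.differentiableAt (by norm_num)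
  have hderiv : deriv (fun s : ℝ => f (x + s • v)) =ᶠ[𝓝 0] fun s => fderiv ℝ f (x + s • v) v := by
    filter_upwards [hcont.eventually hdiff] with s hs
    exact (hs.hasFDerivAt.comp_hasDerivAt s (hline s)).deriv
  have hfd : HasFDerivAt (fderiv ℝ f) (fderiv ℝ (fderiv ℝ f) x) (x + (0 : ℝ) • v) := by
    rw [zero_smul, add_zero]
    exact ((hf.fderiv_right (m := 1) (by norm_num)).differentiableAt (by norm_num)).hasFDerivAt
  have hderiv2 : deriv (deriv fun s : ℝ => f (x + s • v)) 0 = fderiv ℝ (fderiv ℝ f) x v v := by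
    rw [hderiv.deriv_eq]
    have h1 : HasDerivAt (fun s : ℝ => fderiv ℝ f (x + s • v)) (fderiv ℝ (fderiv ℝ f) x v) 0 :=
      hfd.comp_hasDerivAt 0 (hline 0)
    simpa using (h1.clm_apply (hasDerivAt_const 0 v)).deriv
  have hmin' : IsLocalMin (fun s : ℝ => f (x + s • v)) 0 := by
    simpa [IsLocalMin, IsMinFilter] using hcont.eventually hmin
  rw [← hderiv2]
  by_contra! hneg
  have hc : ContinuousAt (fun s : ℝ => f (x + s • v)) 0 := by
    have : ContinuousAt f (x + (0 : ℝ) • v) := by simpa using hf.continuousAt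
    exact this.comp (f := fun s : ℝ => x + s • v) (hline 0).continuousAt
  -- With a negative second derivative the point would also be a local maximum, and the function
  -- would be locally constant along the line.
  have hmax := isLocalMax_of_deriv_deriv_neg hneg hmin'.deriv_eq_zero hc
  have hconst : (fun s : ℝ => f (x + s • v)) =ᶠ[𝓝 0] fun _ => f (x + (0 : ℝ) • v) := by
    filter_upwards [hmin', hmax] with s h1 h2 using le_antisymm h2 h1
  have h0 : deriv (deriv fun s : ℝ => f (x + s • v)) 0 = 0 := by
    rw [hconst.deriv.deriv_eq]
    simp
  exact hneg.ne h0

/-- The trace of the product of two positive semidefinite real matrices is nonnegative. -/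
lemma Matrix.PosSemidef.sum_mul_nonneg {ι : Type*} [Fintype ι] {A B : Matrix ι ι ℝ}
    (hA : A.PosSemidef) (hB : B.PosSemidef) : 0 ≤ ∑ i, ∑ j, A i j * B i j := by
  simpa [dotProduct, Matrix.mulVec] using (hA.hadamard hB).dotProduct_mulVec_nonneg 1

/-- The one-sided first-order necessary condition at a minimum on an interval that is attained at
its right endpoint. -/
lemma IsMinOn.hasDerivWithinAt_Icc_right_nonpos {k : ℝ → ℝ} {k' a b : ℝ} (hab : a < b)
    (hmin : IsMinOn k (Icc a b) b) (hk : HasDerivWithinAt k k' (Icc a b) b) : k' ≤ 0 := by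
  have h := hmin.localize.hasFDerivWithinAt_nonneg hk.hasFDerivWithinAt
    (mem_posTangentConeAt_of_segment_subset (y := a - b)
      (by rw [add_sub_cancel, segment_symm, segment_eq_Icc hab.le]))
  rw [ContinuousLinearMap.toSpanSingleton_apply, smul_eq_mul] at h
  nlinarith

namespace ScalarMax

section

variable {n : ℕ} {M : Type*} [TopologicalSpace M] [ChartedSpace (EuclideanSpace ℝ (Fin n)) M]
  [IsManifold (𝓡 n) ∞ M]

/-! ### The Laplacian at a minimum -/

/-- The matrix is in fact positive definite on the chart domain. Semidefiniteness holds at every `y`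
without the linear independence of the coordinate fields, and is inherited by the inverse matrix,
which is all that the sign of the Laplacian requires. -/
lemma metricMatrix_posSemidef (g : Metric n M) (p : M) (y : EuclideanSpace ℝ (Fin n)) :
    (metricMatrix g p y).PosSemidef := by
  refine .of_dotProduct_mulVec_nonneg ?_ fun c => ?_
  · ext i j
    exact g.symm _ _ _
  · have key : star c ⬝ᵥ (metricMatrix g p y).mulVec c
        = g.inner _ (∑ i, c i • coordVector p i y) (∑ i, c i • coordVector p i y) := by
      simp only [dotProduct, Matrix.mulVec, metricMatrix, Finset.mul_sum, map_sum, map_smul,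
        sum_apply, smul_apply, Matrix.of_apply,
        star_trivial, smul_eq_mul]
      rw [Finset.sum_comm]
      exact Finset.sum_congr rfl fun i _ => Finset.sum_congr rfl fun j _ => by ring
    rw [key]
    by_cases h : ∑ i, c i • coordVector p i y = 0
    · rw [h, map_zero]
    · exact (g.pos _ _ h).le

lemma laplacian_nonneg_of_isLocalMin (g : Metric n M) {f : M → ℝ} {p : M}
    (hf : ContMDiff (𝓡 n) 𝓘(ℝ, ℝ) 2 f) (hmin : IsLocalMin f p) : 0 ≤ laplacian g f p := by
  set y := extChartAt (𝓡 n) p p with hy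
  set h := f ∘ (extChartAt (𝓡 n) p).symm with hh
  have hsymm : (extChartAt (𝓡 n) p).symm y = p := by simp [hy]
  have hC2 : ContDiffAt ℝ 2 h y := by
    have h1 : ContMDiffOn 𝓘(ℝ, EuclideanSpace ℝ (Fin n)) 𝓘(ℝ, ℝ) 2 h
        (extChartAt (𝓡 n) p).target :=
      hf.comp_contMDiffOn ((contMDiffOn_extChartAt_symm (n := ∞) p).of_le ENat.LEInfty.out)
    exact (contMDiffOn_iff_contDiffOn.mp h1).contDiffAt (extChartAt_target_mem_nhds p)
  have hmin' : IsLocalMin h y := by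
    have hc : Tendsto (extChartAt (𝓡 n) p).symm (𝓝 y) (𝓝 p) := by
      exact (continuousAt_extChartAt_symm (I := 𝓡 n) p).tendsto.trans_eq (by rw [extChartAt_to_inv])
    filter_upwards [hc.eventually hmin] with z hz
    rwa [hh, Function.comp_apply, hsymm]
  have hd : DifferentiableAt ℝ (fderiv ℝ h) y :=
    (hC2.fderiv_right (m := 1) (by norm_num)).differentiableAt (by norm_num)
  have hhess (i j : Fin n) : hessian g f p i j y =
      fderiv ℝ (fderiv ℝ h) y (EuclideanSpace.single i 1) (EuclideanSpace.single j 1) := by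
    have h1 (k : Fin n) : partialDeriv k h y = 0 := by
      simp [partialDeriv, hmin'.fderiv_eq_zero]
    have h2 : HasFDerivAt (partialDeriv j h) _ y :=
      hd.hasFDerivAt.clm_apply (hasFDerivAt_const (EuclideanSpace.single j (1 : ℝ)) y)
    simp only [hessian, ← hh, h1]
    rw [partialDeriv, h2.fderiv]
    simp
  have hpos : (Matrix.of fun i j => hessian g f p i j y).PosSemidef := by
    refine .of_dotProduct_mulVec_nonneg ?_ fun c => ?_
    · ext i j
      simp only [Matrix.conjTranspose_apply, Matrix.of_apply, hhess, star_trivial]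
      exact (hC2.isSymmSndFDerivAt (by simp)).eq _ _
    · refine (hmin'.fderiv_fderiv_nonneg hC2
        (∑ i, c i • EuclideanSpace.single i (1 : ℝ))).trans_eq ?_
      simp only [dotProduct, Matrix.mulVec, hhess, Finset.mul_sum, map_sum, map_smul,
        sum_apply, smul_apply, Matrix.of_apply,
        star_trivial, smul_eq_mul]
      rw [Finset.sum_comm]
      exact Finset.sum_congr rfl fun i _ => Finset.sum_congr rfl fun j _ => by ring
  exact (metricMatrix_posSemidef g p y).inv.sum_mul_nonneg hpos

/-! ### Sign change -/

lemma laplacian_neg (g : Metric n M) (f : M → ℝ) (p : M) :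
    laplacian g (fun y => -f y) p = -laplacian g f p := by
  have hpd (i : Fin n) (h : EuclideanSpace ℝ (Fin n) → ℝ) :
      partialDeriv i (-h) = -partialDeriv i h := by
    ext y
    simp [partialDeriv, fderiv_neg]
  have hc (p : M) : (fun y => -f y) ∘ (extChartAt (𝓡 n) p).symm
      = -(f ∘ (extChartAt (𝓡 n) p).symm) := rfl
  have hhess (i j : Fin n) (y) :
      hessian g (fun y => -f y) p i j y = -hessian g f p i j y := by
    simp only [hessian, hc, hpd, Pi.neg_apply, mul_neg, Finset.sum_neg_distrib]
    ring
  simp [laplacian, hhess]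

lemma IsSubsolution.neg {g : ℝ → Metric n M} {F : ℝ → ℝ} {J : Set ℝ} {u : M → ℝ → ℝ}
    (hu : IsSubsolution g F J u) :
    IsSupersolution g (fun a => -F (-a)) J (fun x t => -u x t) where
  isC2 := by
    have := hu.isC2
    unfold IsC2On at this ⊢
    exact this.neg
  ge x t ht := by
    have := hu.le x t ht
    rw [laplacian_neg, derivWithin.fun_neg, neg_neg]
    linarith

lemma IsODESolution.neg {F : ℝ → ℝ} {C : ℝ} {K : Set ℝ} {φ : ℝ → ℝ}
    (hφ : IsODESolution F C K φ) :
    IsODESolution (fun a => -F (-a)) (-C) K (fun t => -φ t) where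
  ordConnected := hφ.ordConnected
  zero_mem := hφ.zero_mem
  initial := by rw [hφ.initial]
  hasDeriv t ht := by simpa using (hφ.hasDeriv t ht).fun_neg

/-! ### Comparison with the ordinary differential equation -/

omit [IsManifold (𝓡 n) ∞ M] in
lemma IsC2On.contMDiff_slice {J : Set ℝ} {u : M → ℝ → ℝ} (hu : IsC2On (n := n) J u) {t : ℝ}
    (ht : t ∈ J) : ContMDiff (𝓡 n) 𝓘(ℝ, ℝ) 2 fun x => u x t := by
  rw [← contMDiffOn_univ]
  exact ContMDiffOn.comp (t := univ ×ˢ J) hu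
    (contMDiff_id.prodMk contMDiff_const).contMDiffOn fun x _ => ⟨mem_univ _, ht⟩

omit [IsManifold (𝓡 n) ∞ M] in
lemma IsC2On.hasDerivWithinAt {J : Set ℝ} {u : M → ℝ → ℝ} (hu : IsC2On (n := n) J u) (x : M)
    {t : ℝ} (ht : t ∈ J) :
    HasDerivWithinAt (fun s => u x s) (derivWithin (fun s => u x s) J t) J t := by
  have h : ContMDiffOn 𝓘(ℝ, ℝ) 𝓘(ℝ, ℝ) 2 (fun s => u x s) J :=
    ContMDiffOn.comp (t := univ ×ˢ J) hu
      (contMDiff_const.prodMk contMDiff_id).contMDiffOn fun s hs => ⟨mem_univ _, hs⟩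
  exact ((contMDiffOn_iff_contDiffOn.mp h).differentiableOn (by norm_num) t ht).hasDerivWithinAt

/-- Comparison of a supersolution with a solution of the ordinary differential equation. -/
lemma IsSupersolution.le_of_isODESolution [CompactSpace M] {J : Set ℝ} (hJ : J.OrdConnected)
    (hJ_zero : (0 : ℝ) ∈ J) (hJ_nonneg : ∀ t ∈ J, 0 ≤ t) {g : ℝ → Metric n M} {F : ℝ → ℝ}
    (hF : LocallyLipschitz F) {u : M → ℝ → ℝ} {C : ℝ} {K : Set ℝ} {φ : ℝ → ℝ}
    (hu : IsSupersolution g F J u) (h0 : ∀ x, C ≤ u x 0) (hφ : IsODESolution F C K φ)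
    (x : M) {T : ℝ} (hTJ : T ∈ J) (hTK : T ∈ K) : φ T ≤ u x T := by
  have hT0 := hJ_nonneg T hTJ
  have hsubJ : Icc 0 T ⊆ J := hJ.out hJ_zero hTJ
  have hsubK : Icc 0 T ⊆ K := hφ.ordConnected.out hφ.zero_mem hTK
  have hcu : ContinuousOn (fun q : M × ℝ => u q.1 q.2) (univ ×ˢ Icc 0 T) :=
    (ContMDiffOn.continuousOn hu.isC2).mono (prod_mono_right hsubJ)
  have hcφ : ContinuousOn φ (Icc 0 T) := fun t ht =>
    (hφ.hasDeriv t (hsubK ht)).continuousWithinAt.mono hsubK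
  have hcpt : IsCompact ((univ : Set M) ×ˢ Icc 0 T) := isCompact_univ.prod isCompact_Icc
  obtain ⟨L, hL⟩ := (hF.locallyLipschitzOn (s := (fun q : M × ℝ => u q.1 q.2) ''
    (univ ×ˢ Icc 0 T) ∪ φ '' Icc 0 T)).exists_lipschitzOnWith_of_compact
    ((hcpt.image_of_continuousOn hcu).union (isCompact_Icc.image_of_continuousOn hcφ))
  -- The rate `L + 1` exceeds `L`, so that `(L + 1) (u - φ) < L (u - φ)` where `u < φ`.
  set w : M × ℝ → ℝ := fun q => Real.exp (-((L : ℝ) + 1) * q.2) * (u q.1 q.2 - φ q.2)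
  have hcw : ContinuousOn w (univ ×ˢ Icc 0 T) :=
    (by fun_prop : Continuous fun q : M × ℝ => Real.exp (-((L : ℝ) + 1) * q.2)).continuousOn.mul
      (hcu.sub (hcφ.comp continuousOn_snd fun q hq => hq.2))
  obtain ⟨⟨x₀, t₀⟩, ⟨-, ht₀⟩, hmin⟩ :=
    hcpt.exists_isMinOn ⟨(x, T), mem_univ _, right_mem_Icc.2 hT0⟩ hcw
  by_contra! hlt
  have hneg : u x₀ t₀ - φ t₀ < 0 := by
    have h1 : w (x₀, t₀) ≤ w (x, T) := hmin ⟨mem_univ _, right_mem_Icc.2 hT0⟩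
    have h2 : w (x, T) < 0 := mul_neg_of_pos_of_neg (Real.exp_pos _) (sub_neg.2 hlt)
    exact (pos_iff_neg_of_mul_neg (h1.trans_lt h2)).1 (Real.exp_pos _)
  have ht₀pos : 0 < t₀ := by
    refine ht₀.1.lt_of_ne ?_
    rintro rfl
    rw [hφ.initial] at hneg
    linarith [h0 x₀]
  have hsub : Icc 0 t₀ ⊆ Icc 0 T := Icc_subset_Icc_right ht₀.2
  have hlap : 0 ≤ laplacian (g t₀) (fun y => u y t₀) x₀ := by
    refine laplacian_nonneg_of_isLocalMin _ (hu.isC2.contMDiff_slice (hsubJ ht₀)) ?_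
    refine Eventually.of_forall fun z => ?_
    have h1 : w (x₀, t₀) ≤ w (z, t₀) := hmin ⟨mem_univ _, ht₀⟩
    have h2 := le_of_mul_le_mul_left h1 (Real.exp_pos _)
    exact (sub_le_sub_iff_right _).1 h2
  have hFL : F (φ t₀) - F (u x₀ t₀) ≤ L * (φ t₀ - u x₀ t₀) := by
    have h1 := hL.dist_le_mul (φ t₀) (.inr ⟨t₀, ht₀, rfl⟩) (u x₀ t₀)
      (.inl ⟨(x₀, t₀), ⟨mem_univ _, ht₀⟩, rfl⟩)
    rw [Real.dist_eq, Real.dist_eq, abs_of_pos (a := φ t₀ - u x₀ t₀) (by linarith)] at h1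
    exact (le_abs_self _).trans h1
  have hexp : HasDerivAt (fun s => Real.exp (-((L : ℝ) + 1) * s))
      (Real.exp (-((L : ℝ) + 1) * t₀) * -((L : ℝ) + 1)) t₀ := by
    simpa using ((hasDerivAt_id t₀).const_mul (-((L : ℝ) + 1))).exp
  have hd := hexp.hasDerivWithinAt.mul
    (((hu.isC2.hasDerivWithinAt x₀ (hsubJ ht₀)).mono (hsub.trans hsubJ)).sub
      ((hφ.hasDeriv t₀ (hsubK ht₀)).mono (hsub.trans hsubK)))
  have hmin₀ : IsMinOn (fun s => w (x₀, s)) (Icc 0 t₀) t₀ := fun s hs =>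
    hmin (show (x₀, s) ∈ univ ×ˢ Icc 0 T from ⟨mem_univ _, hsub hs⟩)
  have hle := IsMinOn.hasDerivWithinAt_Icc_right_nonpos ht₀pos hmin₀ hd
  have hge := hu.ge x₀ t₀ (hsubJ ht₀)
  have hle' : derivWithin (fun s => u x₀ s) J t₀ - F (φ t₀)
      - ((L : ℝ) + 1) * (u x₀ t₀ - φ t₀) ≤ 0 := by
    refine nonpos_of_mul_nonpos_right (a := Real.exp (-((L : ℝ) + 1) * t₀)) ?_ (Real.exp_pos _)
    refine le_trans (le_of_eq ?_) hle
    simp only [Pi.sub_apply]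
    ring
  linarith

end

end ScalarMax

theorem mainTheorem4 {n : ℕ} {M : Type*} [TopologicalSpace M] [T2Space M] [CompactSpace M]
    [ChartedSpace (EuclideanSpace ℝ (Fin n)) M] [IsManifold (𝓡 n) ∞ M]
    (J : Set ℝ) (hJ : J.OrdConnected) (hJ_zero : (0 : ℝ) ∈ J) (hJ_nonneg : ∀ t ∈ J, 0 ≤ t)
    (g : ℝ → ScalarMax.Metric n M) (F : ℝ → ℝ) (hF : LocallyLipschitz F) :
    (∀ (u : M → ℝ → ℝ) (C₁ : ℝ) (K : Set ℝ) (φ₁ : ℝ → ℝ),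
      ScalarMax.IsSupersolution g F J u →
      (∀ x, u x 0 ≥ C₁) →
      ScalarMax.IsODESolution F C₁ K φ₁ →
      ∀ x, ∀ t ∈ J ∩ K, u x t ≥ φ₁ t) ∧
    (∀ (u : M → ℝ → ℝ) (C₂ : ℝ) (K : Set ℝ) (φ₂ : ℝ → ℝ),
      ScalarMax.IsSubsolution g F J u →
      (∀ x, u x 0 ≤ C₂) →
      ScalarMax.IsODESolution F C₂ K φ₂ →
      ∀ x, ∀ t ∈ J ∩ K, u x t ≤ φ₂ t) := by
  refine ⟨fun u C₁ K φ₁ hu h0 hφ x t ht =>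
    hu.le_of_isODESolution hJ hJ_zero hJ_nonneg hF h0 hφ x ht.1 ht.2,
    fun u C₂ K φ₂ hu h0 hφ x t ht => ?_⟩
  have hF' : LocallyLipschitz fun a => -F (-a) := fun a => by
    obtain ⟨L, s, hs, hL⟩ := hF (-a)
    refine ⟨L, Neg.neg ⁻¹' s, continuous_neg.continuousAt.preimage_mem_nhds hs, fun b hb c hc => ?_⟩
    simpa using hL hb hc
  exact neg_le_neg_iff.1 <| hu.neg.le_of_isODESolution hJ hJ_zero hJ_nonneg hF'
    (fun x => neg_le_neg (h0 x)) hφ.neg x ht.1 ht.2
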